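/- Let $\mathcal C$ be an elementary topos (a cartesian closed category with finite limits and a subobject classifier) and let $p:E\to B$ be an arrow of $\mathcal C$, with chosen pullbacks along $p$. Let $T^p=p^*p_*$ be the monad on $\mathcal C\downarrow E$ arising from the adjunction $p_*\dashv p^*$ between post-composition with $p$ and pullback along $p$. For $\gamma:C\to E$ let $\pi_2:E\times_BC\to C$ be the second projection of the chosen pullback of $p\circ\gamma$ along $p$, so that $T^p\gamma$ is the first projection. Let $des(p)$ be the category of descent data: its objects are the pairs $(\gamma,\xi)$ with $\gamma:C\to E$ and $\xi:T^p\gamma\to\gamma$ an Eilenberg–Moore algebra for $T^p$, and its arrows are the algebra morphisms. Let $pb(p)$ be the category whose objects are all (not only the chosen) pullback squares $\alpha\circ q=p\circ\gamma$ with $\gamma:C\to E$, $\alpha:A\to B$, $q:C\to A$. An arrow to $\alpha'\circ q'=p\circ\gamma'$ is a pair of arrows $m_1:\gamma\to\gamma'$ of $\mathcal C\downarrow E$ and $m_2:\alpha\to\alpha'$ of $\mathcal C\downarrow B$ with $q'\circ m_1=m_2\circ q$. The functor $\Phi^p:pb(p)\to des(p)$ sends a pullback square to $(\gamma,\xi^\alpha)$,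 where $\xi^\alpha:T^p\gamma\to\gamma$ is the unique arrow of $\mathcal C\downarrow E$ with $q\circ\xi^\alpha=q\circ\pi_2$, and sends $(m_1,m_2)$ to $m_1$. Given a choice of a coequalizer $c:C\to H$ of $\pi_2$ and $\xi$ for each object $(\gamma,\xi)$ of $des(p)$, the functor $\Psi^p$ sends $(\gamma,\xi)$ to the square $\alpha\circ c=p\circ\gamma$, where $\alpha:H\to B$ is the unique arrow making it commute, and sends an arrow $h$ to $(h,m_2)$ with the unique possible $m_2$. Such choices of coequalizers exist, and for each of them all squares $\Psi^p(\gamma,\xi)$ are pullbacks, so that $\Psi^p:des(p)\to pb(p)$; this functor is left adjoint to $\Phi^p$ through the bijection $(m_1,m_2)\mapsto m_1$ of hom-sets. Moreover: a) For each choice of coequalizers in the construction of $\Psi^p$, $\Phi^p\Psi^p$ equals the identity functor of $des(p)$, and the unit of the adjunction $\Psi^p\dashv\Phi^p$ is the identity. b) If $p$ is an epimorphism, then $\Phi^p:pb(p)\to des(p)$ is an equivalence of categories. Moreover, for every class $S$ of pullback squares on which $\Phi^p$ is injective on objects (for example, a single square), the coequalizers in the construction of $\Psi^p$ can be chosen such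 that, for every square $sqr$ in $S$, $\Psi^p\Phi^p(sqr)=sqr$ and the co-unit at $sqr$ is the identity. -/

import Mathlib

open CategoryTheory CategoryTheory.Limits

universe v u

noncomputable section

namespace DescentPullback

variable {C : Type u} [Category.{v} C] {E B : C}

/-- The monad `T^p = p^* ∘ p_*` on `C ↓ E` arising from the adjunction `p_* ⊣ p^*` between
post-composition with `p` and the chosen pullbacks along `p`. -/
abbrev pullbackMonad (p : E ⟶ B) [ChosenPullbacksAlong p] : Monad (Over E) :=
  (ChosenPullbacksAlong.mapPullbackAdj p).toMonad

/-- The category `des(p)` of descent data relative to `p`: objects are pairs `(γ, ξ)` of an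
object `γ : C ⟶ E` of `C ↓ E` and an arrow `ξ : T^p γ ⟶ γ` of `C ↓ E` that is neutral and
associative; arrows are the arrows of `C ↓ E` that are compatible with the structure arrows. -/
abbrev Des (p : E ⟶ B) [ChosenPullbacksAlong p] := (pullbackMonad p).Algebra

/-- The second projection `π₂ : E ×_B C ⟶ C` of the chosen pullback of `p ∘ γ` along `p`. -/
abbrev proj₂ (p : E ⟶ B) [ChosenPullbacksAlong p] (γ : Over E) :
    ((pullbackMonad p).obj γ).left ⟶ γ.left :=
  ((ChosenPullbacksAlong.mapPullbackAdj p).counit.app ((Over.map p).obj γ)).left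

/-- Commutative squares over `p`: an object consists of `γ : C ⟶ E`, `α : A ⟶ B` and a top arrow
`q : C ⟶ A` with `α ∘ q = p ∘ γ`; an arrow is a pair `(m₁, m₂)` of an arrow of `C ↓ E` and an
arrow of `C ↓ B` that commutes with the top arrows. -/
abbrev Sq (p : E ⟶ B) := Comma (Over.map p) (𝟭 (Over B))

/-- The top arrow `q : C ⟶ A` of a square. -/
abbrev Sq.top {p : E ⟶ B} (X : Sq p) : X.left.left ⟶ X.right.left := X.hom.left

/-- The property of a square over `p` of being a (not necessarily chosen) pullback. -/
def isPullbackSq (p : E ⟶ B) : ObjectProperty (Sq p) :=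
  fun X => IsPullback X.top X.left.hom X.right.hom p

/-- The category `pb(p)` of all pullback squares along `p`. -/
abbrev Pb (p : E ⟶ B) := (isPullbackSq p).FullSubcategory

section Basic

lemma Sq.top_w {p : E ⟶ B} (X : Sq p) : X.top ≫ X.right.hom = X.left.hom ≫ p :=
  Over.w X.hom

lemma Sq.hom_top {p : E ⟶ B} {X Y : Sq p} (m : X ⟶ Y) :
    m.left.left ≫ Y.top = X.top ≫ m.right.left :=
  congrArg CommaMorphism.left m.w

variable (p : E ⟶ B) [ChosenPullbacksAlong p]

lemma proj₂_naturality {γ γ' : Over E} (h : γ ⟶ γ') :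
    ((pullbackMonad p).map h).left ≫ proj₂ p γ' = proj₂ p γ ≫ h.left :=
  congrArg CommaMorphism.left
    ((ChosenPullbacksAlong.mapPullbackAdj p).counit.naturality ((Over.map p).map h))

lemma unit_proj₂ (γ : Over E) : ((pullbackMonad p).η.app γ).left ≫ proj₂ p γ = 𝟙 γ.left :=
  congrArg CommaMorphism.left
    ((ChosenPullbacksAlong.mapPullbackAdj p).left_triangle_components γ)

lemma mul_proj₂ (γ : Over E) :
    ((pullbackMonad p).μ.app γ).left ≫ proj₂ p γ =
      proj₂ p ((pullbackMonad p).obj γ) ≫ proj₂ p γ :=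
  congrArg CommaMorphism.left ((ChosenPullbacksAlong.mapPullbackAdj p).counit.naturality
    ((ChosenPullbacksAlong.mapPullbackAdj p).counit.app ((Over.map p).obj γ)))

lemma proj₂_w (γ : Over E) :
    proj₂ p γ ≫ γ.hom ≫ p = ((pullbackMonad p).obj γ).hom ≫ p :=
  Over.w ((ChosenPullbacksAlong.mapPullbackAdj p).counit.app ((Over.map p).obj γ))

end Basic

section Phi

lemma Pb.hom_ext_left {p : E ⟶ B} (X : Pb p) {γ : Over E} {f g : γ ⟶ X.obj.left}
    (h : f.left ≫ X.obj.top = g.left ≫ X.obj.top) : f = g :=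
  Over.OverMorphism.ext (X.property.hom_ext h ((Over.w f).trans (Over.w g).symm))

variable (p : E ⟶ B) [ChosenPullbacksAlong p]

/-- The canonical descent data `ξ^α : T^p γ ⟶ γ` of a pullback square: the unique arrow of
`C ↓ E` with `q ∘ ξ^α = q ∘ π₂`. -/
def canonicalDescent (X : Pb p) : (pullbackMonad p).obj X.obj.left ⟶ X.obj.left :=
  Over.homMk
    (X.property.lift (proj₂ p X.obj.left ≫ X.obj.top) ((pullbackMonad p).obj X.obj.left).hom
      (by rw [Category.assoc, Sq.top_w, proj₂_w]))
    (X.property.lift_snd _ _ _)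

lemma canonicalDescent_top (X : Pb p) :
    (canonicalDescent p X).left ≫ X.obj.top = proj₂ p X.obj.left ≫ X.obj.top :=
  X.property.lift_fst _ _ _

/-- The functor `Φ^p : pb(p) ⟶ des(p)`: it sends a pullback square to `(γ, ξ^α)` and `(m₁, m₂)`
to `m₁`. -/
def Phi : Pb p ⥤ Des p where
  obj X :=
    { A := X.obj.left
      a := canonicalDescent p X
      unit := X.hom_ext_left (by
        rw [Over.comp_left, Category.assoc, canonicalDescent_top, reassoc_of% unit_proj₂ p]
        exact (Category.id_comp _).symm)
      assoc := X.hom_ext_left (by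
        rw [Over.comp_left, Over.comp_left, Category.assoc, Category.assoc,
          canonicalDescent_top, reassoc_of% mul_proj₂ p, reassoc_of% proj₂_naturality p, canonicalDescent_top]) }
  map {X Y} m :=
    { f := m.hom.left
      h := Y.hom_ext_left (by
        have e := Sq.hom_top m.hom
        refine (Category.assoc _ _ _).trans ?_
        refine (congrArg (_ ≫ ·) (canonicalDescent_top p Y)).trans ?_
        refine ((reassoc_of% proj₂_naturality p m.hom.left) Y.obj.top).trans ?_
        refine (congrArg (_ ≫ ·) e).trans ?_
        refine ((reassoc_of% canonicalDescent_top p X) _).symm.trans ?_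
        refine (congrArg (_ ≫ ·) e.symm).trans ?_
        exact (Category.assoc _ _ _).symm) }

end Phi

section Psi

variable (p : E ⟶ B) [ChosenPullbacksAlong p]

/-- A coequalizer `c : C ⟶ H` in the ambient category of `π₂` and `ξ`, for descent data
`(γ, ξ)`. -/
structure DescentCoequalizer (D : Des p) where
  /-- The object `H`. -/
  pt : C
  /-- The coequalizing arrow `c`. -/
  c : D.A.left ⟶ pt
  w : proj₂ p D.A ≫ c = D.a.left ≫ c
  isColimit : IsColimit (Cofork.ofπ c w)

/-- A choice of coequalizers, one for each object of `des(p)`. -/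
abbrev CoequalizerChoice := ∀ D : Des p, DescentCoequalizer p D

variable {p}

lemma descent_w (D : Des p) :
    proj₂ p D.A ≫ D.A.hom ≫ p = D.a.left ≫ D.A.hom ≫ p := by
  rw [proj₂_w, Over.w_assoc D.a]

/-- The unique `α : H ⟶ B` with `α ∘ c = p ∘ γ`. -/
def DescentCoequalizer.mediate {D : Des p} (K : DescentCoequalizer p D) : K.pt ⟶ B :=
  Cofork.IsColimit.desc K.isColimit (D.A.hom ≫ p) (descent_w D)

lemma DescentCoequalizer.c_mediate {D : Des p} (K : DescentCoequalizer p D) :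
    K.c ≫ K.mediate = D.A.hom ≫ p :=
  Cofork.IsColimit.π_desc' K.isColimit _ (descent_w D)

lemma DescentCoequalizer.hom_ext {D : Des p} (K : DescentCoequalizer p D) {Z : C}
    {f g : K.pt ⟶ Z} (h : K.c ≫ f = K.c ≫ g) : f = g :=
  Cofork.IsColimit.hom_ext K.isColimit h

/-- The square with left side `γ`, top arrow `c` and right side `α`. -/
def DescentCoequalizer.square {D : Des p} (K : DescentCoequalizer p D) : Sq p where
  left := D.A
  right := Over.mk K.mediate
  hom := Over.homMk K.c K.c_mediate

/-- If `q' ∘ m₁` coequalizes `π₂` and `ξ`, then `m₁` extends uniquely to an arrow `(m₁, m₂)` of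
squares out of the coequalizer square. -/
def DescentCoequalizer.desc {D : Des p} (K : DescentCoequalizer p D) (Y : Sq p)
    (m : D.A ⟶ Y.left)
    (hm : proj₂ p D.A ≫ m.left ≫ Y.top = D.a.left ≫ m.left ≫ Y.top) : K.square ⟶ Y where
  left := m
  right := Over.homMk (Cofork.IsColimit.desc K.isColimit (m.left ≫ Y.top) hm)
    (K.hom_ext (by
      refine (Category.assoc _ _ _).symm.trans ?_
      refine (congrArg (· ≫ _) (Cofork.IsColimit.π_desc' K.isColimit _ hm)).trans ?_
      refine (Category.assoc _ _ _).trans ?_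
      refine (congrArg (_ ≫ ·) Y.top_w).trans ?_
      refine (Over.w_assoc m p).trans ?_
      exact K.c_mediate.symm))
  w := Over.OverMorphism.ext (Cofork.IsColimit.π_desc' K.isColimit _ hm).symm

lemma DescentCoequalizer.square_hom_ext {D : Des p} (K : DescentCoequalizer p D) {Y : Sq p}
    {f g : K.square ⟶ Y} (h : f.left = g.left) : f = g :=
  CommaMorphism.ext h (Over.OverMorphism.ext (K.hom_ext (by
    have hf := Sq.hom_top f
    have hg := Sq.hom_top g
    rw [h] at hf
    exact hf.symm.trans hg)))

lemma hom_coequalizes {D D' : Des p} (h : D ⟶ D') {Z : C} (q : D'.A.left ⟶ Z)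
    (w : proj₂ p D'.A ≫ q = D'.a.left ≫ q) :
    proj₂ p D.A ≫ h.f.left ≫ q = D.a.left ≫ h.f.left ≫ q := by
  have e : ((pullbackMonad p).map h.f).left ≫ D'.a.left = D.a.left ≫ h.f.left :=
    congrArg CommaMorphism.left h.h
  rw [← reassoc_of% proj₂_naturality p, w, reassoc_of% e]

/-- The functor `Ψ^p` for a choice of coequalizers, with values in commutative squares over `p`:
it sends `(γ, ξ)` to the square `α ∘ c = p ∘ γ` and an arrow `h` to `(h, m₂)` with the unique
possible `m₂`. -/
def PsiSq (K : CoequalizerChoice p) : Des p ⥤ Sq p where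
  obj D := (K D).square
  map {D D'} h := (K D).desc (K D').square h.f (hom_coequalizes h _ (K D').w)
  map_id D := (K D).square_hom_ext rfl
  map_comp _ _ := (K _).square_hom_ext rfl

/-- The functor `Ψ^p : des(p) ⟶ pb(p)`, available once the squares above are pullbacks. -/
def Psi (K : CoequalizerChoice p) (hK : ∀ D, isPullbackSq p ((PsiSq K).obj D)) : Des p ⥤ Pb p :=
  (isPullbackSq p).lift (PsiSq K) hK

/-- The adjunction `Ψ^p ⊣ Φ^p`, whose bijection sends `(m₁, m₂)` to `m₁`. -/
def adj (K : CoequalizerChoice p) (hK : ∀ D, isPullbackSq p ((PsiSq K).obj D)) :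
    Psi K hK ⊣ Phi p :=
  Adjunction.mkOfHomEquiv
    { homEquiv := fun D X =>
        { toFun := fun m =>
            { f := m.hom.left
              h := X.hom_ext_left (by
                have e : m.hom.left.left ≫ X.obj.top = (K D).c ≫ m.hom.right.left :=
                  Sq.hom_top m.hom
                refine (Category.assoc _ _ _).trans ?_
                refine (congrArg (_ ≫ ·) (canonicalDescent_top p X)).trans ?_
                refine ((reassoc_of% proj₂_naturality p m.hom.left) X.obj.top).trans ?_
                refine (congrArg (_ ≫ ·) e).trans ?_
                refine (Category.assoc _ _ _).symm.trans ?_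
                refine (congrArg (· ≫ _) (K D).w).trans ?_
                refine (Category.assoc _ _ _).trans ?_
                refine (congrArg (_ ≫ ·) e.symm).trans ?_
                exact (Category.assoc _ _ _).symm) }
          invFun := fun h => ObjectProperty.homMk
            ((K D).desc X.obj h.f (hom_coequalizes h X.obj.top (canonicalDescent_top p X).symm))
          left_inv := fun m => ObjectProperty.hom_ext _ ((K D).square_hom_ext rfl)
          right_inv := fun h => rfl }
      homEquiv_naturality_left_symm := fun _ _ =>
        ObjectProperty.hom_ext _ ((K _).square_hom_ext rfl)
      homEquiv_naturality_right := fun _ _ => rfl }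

end Psi

end DescentPullback

end

/-! An element of `T^p γ` is a pair (x, e) with p(γ(x)) = p(e), and ξ moves x to an element over e.
Thus (π₂, ξ) is an internal equivalence relation on C: jointly monic because ξ(x, e) lies over e,
reflexive by the unit law, Euclidean by associativity (`Des.euclidean`). In a topos it is a kernel
pair (`exists_isKernelPair`), and the epi part of an epi-mono factorization gives the coequalizer c
: C ⟶ H. The comparison of C with the pullback of H ⟶ B along p is mono by the unit law and epi
because epimorphisms are pullback-stable, hence iso: the square is a pullback. As c coequalizes π₂
and ξ, its canonical descent data is ξ itself, which is a). Conversely, the top arrow of any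
pullback square has kernel pair (π₂, ξ^α). If p is epi, so is the top arrow; it is then a
coequalizer and may be the chosen one, which gives b). -/

noncomputable section

namespace DescentPullback

section ElementaryTopos

open MonoidalCategory CartesianMonoidalCategory MonoidalClosed HasSubobjectClassifier

variable {C : Type u} [Category.{v} C]

/-! ### Generalized elements of the subobject classifier -/

section Classifier

variable [HasSubobjectClassifier C]

/-- The arrow `X ⟶ Ω` that is constantly true. -/
def trueHom (X : C) : X ⟶ Ω C :=
  Subobject.Classifier.χ₀ _ X ≫ truth C

lemma comp_trueHom {X Y : C} (f : X ⟶ Y) : f ≫ trueHom Y = trueHom X := by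
  rw [trueHom, ← Category.assoc]
  exact congrArg (· ≫ _) (Subobject.Classifier.isTerminalΩ₀.hom_ext _ _)

lemma comp_χ_self {U X : C} (m : U ⟶ X) [Mono m] : m ≫ χ m = trueHom U :=
  HasSubobjectClassifier.comm m

lemma comp_χ_eq_true_iff {U X Z : C} (m : U ⟶ X) [Mono m] (x : Z ⟶ X) :
    x ≫ χ m = trueHom Z ↔ ∃ y : Z ⟶ U, y ≫ m = x := by
  constructor
  · intro h
    exact ⟨(isPullback_χ m).lift x _ h, (isPullback_χ m).lift_fst _ _ _⟩
  · rintro ⟨y, rfl⟩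
    rw [Category.assoc, comp_χ_self, comp_trueHom]

/-- Arrows into `Ω` are determined by the generalized elements at which they are true. -/
lemma hom_Ω_ext [HasFiniteLimits C] {X : C} {φ ψ : X ⟶ Ω C}
    (h : ∀ ⦃Z : C⦄ (x : Z ⟶ X), x ≫ φ = trueHom Z ↔ x ≫ ψ = trueHom Z) : φ = ψ := by
  obtain ⟨U, m, _, rfl⟩ := Subobject.Classifier.surjective_χ _ φ
  have t : IsTerminal (Ω₀ C) := Subobject.Classifier.isTerminalΩ₀
  have factors : ∀ s : PullbackCone ψ (truth C), ∃ y, y ≫ m = s.fst := fun s =>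
    (comp_χ_eq_true_iff m s.fst).1 ((h s.fst).2
      (s.condition.trans (congrArg (· ≫ truth C) (t.hom_ext _ _))))
  choose l hl using factors
  exact (HasSubobjectClassifier.unique m ψ ⟨⟨(h m).1 (comp_χ_self m)⟩,
    ⟨PullbackCone.IsLimit.mk _ l hl (fun _ => t.hom_ext _ _)
      (fun s k hk _ => by rw [← cancel_mono m, hk, hl])⟩⟩).symm

lemma epi_of_isPullback_of_mono [HasFiniteLimits C] {P A E B : C} {p' : P ⟶ A}
    {m' : P ⟶ E} {m : A ⟶ B} {p : E ⟶ B}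
    (h : IsPullback p' m' m p) [Mono m] [Epi p] : Epi p' := by
  refine ⟨fun {Z} g k hgk => ?_⟩
  have : Mono m' := ⟨fun x y hxy => h.hom_ext (by
    rw [← cancel_mono m, Category.assoc, Category.assoc, h.w, reassoc_of% hxy]) hxy⟩
  -- As `p'` equalizes `g` and `k`, both subobjects of `B` have the same preimage under `p`;
  -- cancelling the epimorphism `p` identifies their classifying arrows.
  have e : χ m = χ (equalizer.ι g k ≫ m) := by
    rw [← cancel_epi p]
    refine hom_Ω_ext fun W x => ?_
    rw [← Category.assoc, ← Category.assoc, comp_χ_eq_true_iff, comp_χ_eq_true_iff]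
    constructor
    · rintro ⟨y, hy⟩
      refine ⟨h.lift y x hy ≫ equalizer.lift p' hgk, ?_⟩
      rw [Category.assoc, equalizer.lift_ι_assoc, h.lift_fst_assoc, hy]
    · rintro ⟨y, hy⟩
      exact ⟨y ≫ equalizer.ι g k, by rw [Category.assoc, hy]⟩
  obtain ⟨y, hy⟩ := (comp_χ_eq_true_iff (equalizer.ι g k ≫ m) m).1 (by rw [← e, comp_χ_self])
  have hy' : y ≫ equalizer.ι g k = 𝟙 _ := by
    rw [← cancel_mono m, Category.assoc, hy, Category.id_comp]
  rw [← Category.id_comp g, ← Category.id_comp k, ← hy', Category.assoc, Category.assoc,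
    equalizer.condition]

end Classifier

/-! ### Images, stable epimorphisms and effective equivalence relations -/

variable [HasFiniteLimits C] [CartesianMonoidalCategory C] [MonoidalClosed C]
  [HasSubobjectClassifier C]

/-- In an elementary topos every arrow is an epimorphism followed by a monomorphism. The image is
the intersection of all subobjects through which the arrow factors. -/
lemma exists_epi_mono_factorization {X Y : C} (f : X ⟶ Y) :
    ∃ (I : C) (e : X ⟶ I) (m : I ⟶ Y), Epi e ∧ Mono m ∧ e ≫ m = f := by
  -- `U` is the object of subobjects of `Y` whose preimage under `f` is all of `X`; `m` consists of
  -- the elements lying in every member of `U`.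
  let t : (ihom Y).obj (Ω C) ⟶ (ihom X).obj (Ω C) := curry (trueHom (X ⊗ (ihom Y).obj (Ω C)))
  let U := equalizer ((pre f).app (Ω C)) t
  let i : U ⟶ (ihom Y).obj (Ω C) := equalizer.ι _ _
  let φ : U ⊗ Y ⟶ Ω C := lift (snd U Y) (fst U Y ≫ i) ≫ (ihom.ev Y).app (Ω C)
  let m : equalizer (curry φ) (curry (trueHom (U ⊗ Y))) ⟶ Y := equalizer.ι _ _
  have hm : m ≫ curry φ = m ≫ curry (trueHom (U ⊗ Y)) := equalizer.condition _ _
  have hi : i ≫ (pre f).app (Ω C) = i ≫ t := equalizer.condition _ _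
  have hf : f ≫ curry φ = f ≫ curry (trueHom (U ⊗ Y)) := by
    rw [← curry_natural_left, ← curry_natural_left, comp_trueHom]
    congr 1
    have h1 : U ◁ f ≫ φ = lift (snd U X) (fst U X) ≫ uncurry (i ≫ (pre f).app (Ω C)) := by
      rw [uncurry_natural_left, uncurry_pre]
      simp only [φ, ← Category.assoc]
      congr 1
      ext <;> simp
    rw [h1, hi, uncurry_natural_left, uncurry_curry, comp_trueHom, comp_trueHom]
  have hmin : ∀ {S : C} (s : S ⟶ Y) [Mono s] (g : X ⟶ S), g ≫ s = f → ∃ k, k ≫ s = m := by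
    intro S s _ g hg
    rw [← comp_χ_eq_true_iff]
    -- The constant family at `s` is a member of `U`, so elements of `m` lie in `s`.
    let n : equalizer (curry φ) (curry (trueHom (U ⊗ Y))) ⟶ (ihom Y).obj (Ω C) :=
      curry (fst _ _ ≫ χ s)
    have hn : n ≫ (pre f).app (Ω C) = n ≫ t := by
      rw [curry_pre_app, ← curry_natural_left, comp_trueHom]
      congr 1
      rw [whiskerRight_fst_assoc, ← hg, Category.assoc, comp_χ_self, comp_trueHom, comp_trueHom]
    let n' : _ ⟶ U := equalizer.lift n hn
    have hn' : n' ≫ i = n := equalizer.lift_ι _ _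
    have h1 : lift n' m ≫ φ = m ≫ χ s := by
      have : lift n' m ≫ φ = lift m (𝟙 _) ≫ uncurry n := by
        rw [uncurry_eq]
        simp only [φ, ← Category.assoc]
        congr 1
        ext <;> simp [hn']
      rw [this, uncurry_curry, lift_fst_assoc]
    have h2 : lift n' m ≫ φ = lift n' (𝟙 _) ≫ uncurry (m ≫ curry φ) := by
      rw [uncurry_natural_left, uncurry_curry, ← Category.assoc (lift n' (𝟙 _))]
      congr 1
      exact CartesianMonoidalCategory.hom_ext _ _ (by simp) (by simp)
    rw [← h1, h2, hm, uncurry_natural_left, uncurry_curry, comp_trueHom, comp_trueHom]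
  refine ⟨_, equalizer.lift f hf, m, ⟨fun {Z} g h hgh => ?_⟩, inferInstance,
    equalizer.lift_ι _ _⟩
  -- `f` also factors through the smaller subobject on which `g` and `h` agree, so by minimality
  -- that subobject is everything.
  obtain ⟨k, hk⟩ := hmin (equalizer.ι g h ≫ m) (equalizer.lift _ hgh) (by
    rw [equalizer.lift_ι_assoc]; exact equalizer.lift_ι _ _)
  have hk' : k ≫ equalizer.ι g h = 𝟙 _ := by
    rw [← cancel_mono m, Category.assoc, hk, Category.id_comp]
  rw [← Category.id_comp g, ← Category.id_comp h, ← hk', Category.assoc, Category.assoc,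
    equalizer.condition]

/-- In an elementary topos epimorphisms are stable under pullback. -/
lemma epi_of_isPullback {P A E B : C} {a : P ⟶ A} {b : P ⟶ E} {f : A ⟶ B} {p : E ⟶ B}
    (h : IsPullback a b f p) [Epi p] : Epi a := by
  -- The pullback along `f` is the pullback of `A ◁ p` along the graph of `f`. The graph is mono,
  -- and `A ◁ p` is epi since tensoring is a left adjoint.
  have : Epi (A ◁ p) :=
    have := (ihom.adjunction A).isLeftAdjoint
    inferInstanceAs (Epi ((tensorLeft A).map p))
  have : Mono (lift (𝟙 A) f) := mono_of_mono_fac (lift_fst (𝟙 A) f)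
  have sq : IsPullback a (lift a b) (lift (𝟙 A) f) (A ◁ p) := by
    refine ⟨⟨by ext <;> simp [h.w]⟩, ⟨PullbackCone.IsLimit.mk _
      (fun s => h.lift s.fst (s.snd ≫ snd _ _) ?_) (fun s => ?_) (fun s => ?_)
      (fun s l h₁ h₂ => ?_)⟩⟩
    · simpa using s.condition =≫ snd _ _
    · simp
    · have := s.condition =≫ fst _ _
      ext
      · simpa using this
      · simp
    · refine h.hom_ext ?_ ?_
      · simpa using h₁
      · simpa using h₂ =≫ snd _ _
  exact epi_of_isPullback_of_mono sq

lemma exists_epi_lift {X Y Z : C} (e : X ⟶ Y) [Epi e] (y : Z ⟶ Y) :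
    ∃ (W : C) (c : W ⟶ Z) (x : W ⟶ X), Epi c ∧ x ≫ e = c ≫ y :=
  ⟨pullback y e, pullback.fst _ _, pullback.snd _ _,
    epi_of_isPullback (IsPullback.of_hasPullback y e), pullback.condition.symm⟩

/-- In an elementary topos every epimorphism is the coequalizer of its kernel pair. -/
lemma exists_desc_of_isKernelPair {R X I Z : C} {e : X ⟶ I} [Epi e] {a b : R ⟶ X}
    (h : IsKernelPair e a b) (f : X ⟶ Z) (hf : a ≫ f = b ≫ f) : ∃ d : I ⟶ Z, e ≫ d = f := by
  -- The image `J` of (e, f) is the graph of the desired arrow: its projection to `I` turns out to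
  -- be invertible.
  obtain ⟨J, q, j, _, _, hqj⟩ := exists_epi_mono_factorization (lift e f)
  have hq₁ : q ≫ j ≫ fst _ _ = e := by rw [reassoc_of% hqj, lift_fst]
  have hq₂ : q ≫ j ≫ snd _ _ = f := by rw [reassoc_of% hqj, lift_snd]
  have : Epi (j ≫ fst I Z) := epi_of_epi_fac hq₁
  have : Mono (j ≫ fst I Z) := by
    refine ⟨fun {T} y z hyz => ?_⟩
    obtain ⟨T₁, c₁, x₁, _, h₁⟩ := exists_epi_lift q y
    obtain ⟨T₂, c₂, x₂, _, h₂⟩ := exists_epi_lift q (c₁ ≫ z)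
    have hx : (c₂ ≫ x₁) ≫ e = x₂ ≫ e := by
      rw [← hq₁, Category.assoc, reassoc_of% h₁, reassoc_of% h₂, hyz]
    have hxf : (c₂ ≫ x₁) ≫ f = x₂ ≫ f := by
      rw [← h.lift_fst _ _ hx, Category.assoc, hf, h.lift_snd_assoc]
    rw [← cancel_epi c₁, ← cancel_epi c₂, ← h₁, ← h₂, ← cancel_mono j, Category.assoc,
      Category.assoc, Category.assoc, hqj]
    ext
    · simpa using hx
    · simpa using hxf
  have := isIso_of_mono_of_epi (j ≫ fst I Z)
  exact ⟨inv (j ≫ fst I Z) ≫ j ≫ snd I Z, by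
    rw [← hq₁, Category.assoc, IsIso.hom_inv_id_assoc, hq₂]⟩

/-- In an elementary topos every internal equivalence relation is a kernel pair: it is the kernel
pair of the arrow that sends an element to its class. The relation is required to be reflexive and
Euclidean. -/
lemma exists_isKernelPair {R X : C} (a b : R ⟶ X)
    (hmono : ∀ ⦃Z : C⦄ (k l : Z ⟶ R), k ≫ a = l ≫ a → k ≫ b = l ≫ b → k = l)
    (i : X ⟶ R) (hia : i ≫ a = 𝟙 X) (hib : i ≫ b = 𝟙 X)
    (heuclid : ∀ ⦃Z : C⦄ (k l : Z ⟶ R), k ≫ a = l ≫ a →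
      ∃ n : Z ⟶ R, n ≫ a = k ≫ b ∧ n ≫ b = l ≫ b) :
    ∃ (Y : C) (r : X ⟶ Y), IsKernelPair r a b := by
  have : Mono (lift a b) := ⟨fun k l h => hmono k l
    (by simpa using h =≫ fst _ _) (by simpa using h =≫ snd _ _)⟩
  have hrel : ∀ {Z : C} (x y : Z ⟶ X), lift x y ≫ χ (lift a b) = trueHom Z ↔
      ∃ k : Z ⟶ R, k ≫ a = x ∧ k ≫ b = y := by
    intro Z x y
    rw [comp_χ_eq_true_iff]
    refine exists_congr fun k => ⟨fun h => ⟨?_, ?_⟩, ?_⟩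
    · simpa using h =≫ fst _ _
    · simpa using h =≫ snd _ _
    · rintro ⟨rfl, rfl⟩
      ext <;> simp
  have hsymm : ∀ {Z : C} (k : Z ⟶ R), ∃ l : Z ⟶ R, l ≫ a = k ≫ b ∧ l ≫ b = k ≫ a := by
    intro Z k
    -- Symmetry: from x ~ y and x ~ x the Euclidean property gives y ~ x.
    obtain ⟨n, h₁, h₂⟩ := heuclid k (k ≫ a ≫ i) (by simp [hia])
    exact ⟨n, h₁, by simpa [hib] using h₂⟩
  have htrans : ∀ {Z : C} (k l : Z ⟶ R), k ≫ b = l ≫ a →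
      ∃ n : Z ⟶ R, n ≫ a = k ≫ a ∧ n ≫ b = l ≫ b := by
    intro Z k l h
    obtain ⟨k', h₁, h₂⟩ := hsymm k
    obtain ⟨n, h₃, h₄⟩ := heuclid k' l (h₁.trans h)
    exact ⟨n, h₃.trans h₂, h₄⟩
  have factors : ∀ s : PullbackCone (curry (χ (lift a b))) (curry (χ (lift a b))),
      ∃ k : s.pt ⟶ R, k ≫ a = s.fst ∧ k ≫ b = s.snd := by
    intro s
    have hs := s.condition
    rw [← curry_natural_left, ← curry_natural_left] at hs
    -- Evaluate the equal classes of `s.fst` and `s.snd` at `s.fst`, which lies in its own class by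
    -- reflexivity.
    have hs' := lift s.fst (𝟙 _) ≫= curry_injective hs
    have e : ∀ c : s.pt ⟶ X, lift s.fst (𝟙 _) ≫ X ◁ c = lift s.fst c := by
      intro c
      ext <;> simp
    rw [← Category.assoc, ← Category.assoc, e, e] at hs'
    rw [← hrel, ← hs', hrel]
    exact ⟨s.fst ≫ i, by simp [hia], by simp [hib]⟩
  choose l hl₁ hl₂ using factors
  refine ⟨_, curry (χ (lift a b)), ⟨⟨?_⟩, ⟨PullbackCone.IsLimit.mk _ l hl₁ hl₂
    (fun s k h₁ h₂ => hmono _ _ (h₁.trans (hl₁ s).symm) (h₂.trans (hl₂ s).symm))⟩⟩⟩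
  rw [← curry_natural_left, ← curry_natural_left]
  congr 1
  refine hom_Ω_ext fun Z x => ?_
  have e : ∀ c : R ⟶ X, x ≫ X ◁ c = lift (x ≫ fst _ _) ((x ≫ snd _ _) ≫ c) := by
    intro c
    ext <;> simp
  rw [← Category.assoc, ← Category.assoc, e, e, hrel, hrel]
  constructor
  · rintro ⟨k, h₁, h₂⟩
    obtain ⟨n, h₃, h₄⟩ := htrans k _ h₂
    exact ⟨n, h₃.trans h₁, h₄⟩
  · rintro ⟨k, h₁, h₂⟩
    obtain ⟨l, h₃, h₄⟩ := hsymm (x ≫ snd X R)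
    obtain ⟨n, h₅, h₆⟩ := htrans k l (h₂.trans h₃.symm)
    exact ⟨n, h₅.trans h₁, h₆.trans h₄⟩

end ElementaryTopos
-- Descent data as equivalence relations, and the unit
-- Injectivity on `S` makes prescribing values along `f` unambiguous; outside the image of `S` the
-- default `d` is used. This yields coequalizer choices adapted to `S`.
lemma exists_extension {α β : Type*} {P : β → Type*} {f : α → β} {S : Set α}
    (hf : Set.InjOn f S) (g : ∀ x, P (f x)) (d : ∀ y, P y) :
    ∃ K : ∀ y, P y, ∀ x ∈ S, K (f x) = g x := by
  classical
  refine ⟨fun y => if h : ∃ x ∈ S, f x = y then h.choose_spec.2 ▸ g h.choose else d y,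
    fun x hx => ?_⟩
  have h : ∃ x' ∈ S, f x' = f x := ⟨x, hx, rfl⟩
  have e : h.choose = x := hf h.choose_spec.1 hx h.choose_spec.2
  refine (dif_pos h).trans ?_
  have key : ∀ (y : α) (hy : f y = f x), y = x → hy ▸ g y = g x := by
    rintro y hy rfl
    rfl
  exact key _ _ e

section Descent

variable {C : Type u} [Category.{v} C] {E B : C} {p : E ⟶ B}

lemma Pb.eqToHom_left {X Y : Pb p} (h : X = Y) :
    (eqToHom h).hom.left = eqToHom (congrArg (·.obj.left) h) := by
  subst h
  rfl

lemma Sq.mk_eq {X : Sq p} {α : X.right.left ⟶ B} (hα : α = X.right.hom)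
    (w : X.top ≫ α = X.left.hom ≫ p) :
    ({ left := X.left, right := Over.mk α, hom := Over.homMk X.top w } : Sq p) = X := by
  subst hα
  rfl

variable [ChosenPullbacksAlong p]

/-- The chosen pullback square defining `T^p γ`. -/
lemma isPullback_proj₂ (γ : Over E) :
    IsPullback (proj₂ p γ) ((pullbackMonad p).obj γ).hom (γ.hom ≫ p) p :=
  ChosenPullbacksAlong.isPullback (γ.hom ≫ p) p

lemma Des.a_hom (D : Des p) : D.a.left ≫ D.A.hom = ((pullbackMonad p).obj D.A).hom :=
  Over.w D.a

lemma Des.hom_ext_proj₂ {D : Des p} {Z : C} {k l : Z ⟶ ((pullbackMonad p).obj D.A).left}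
    (h₁ : k ≫ proj₂ p D.A = l ≫ proj₂ p D.A) (h₂ : k ≫ D.a.left = l ≫ D.a.left) : k = l := by
  refine (isPullback_proj₂ D.A).hom_ext h₁ ?_
  rw [← Des.a_hom, reassoc_of% h₂]

lemma Des.unit_a (D : Des p) : ((pullbackMonad p).η.app D.A).left ≫ D.a.left = 𝟙 D.A.left :=
  congrArg CommaMorphism.left D.unit

lemma Des.mul_a (D : Des p) : ((pullbackMonad p).μ.app D.A).left ≫ D.a.left =
    ((pullbackMonad p).map D.a).left ≫ D.a.left :=
  congrArg CommaMorphism.left D.assoc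

/-- An element of `T^p γ` is determined by, and can be built from, an element `c` of the domain
of `γ` and an element of `E` over the same element of `B`. -/
lemma Des.exists_lift (D : Des p) {Z : C} (c : Z ⟶ D.A.left) (e : Z ⟶ E)
    (h : c ≫ D.A.hom ≫ p = e ≫ p) :
    ∃ k : Z ⟶ ((pullbackMonad p).obj D.A).left,
      k ≫ proj₂ p D.A = c ∧ k ≫ D.a.left ≫ D.A.hom = e :=
  ⟨(isPullback_proj₂ D.A).lift c e h, (isPullback_proj₂ D.A).lift_fst _ _ _, by
    rw [Des.a_hom]; exact (isPullback_proj₂ D.A).lift_snd _ _ _⟩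

/-- Associativity reads ξ(ξ(x, e), e') = ξ(x, e'): if `k` = (x, e) and `l` = (x, e'), then `n` =
(ξ(x, e), e'). -/
lemma Des.euclidean (D : Des p) {Z : C} (k l : Z ⟶ ((pullbackMonad p).obj D.A).left)
    (h : k ≫ proj₂ p D.A = l ≫ proj₂ p D.A) :
    ∃ n : Z ⟶ ((pullbackMonad p).obj D.A).left,
      n ≫ proj₂ p D.A = k ≫ D.a.left ∧ n ≫ D.a.left = l ≫ D.a.left := by
  have hμ := Over.w ((pullbackMonad p).μ.app D.A)
  have hk : k ≫ ((pullbackMonad p).obj D.A).hom ≫ p =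
      (l ≫ ((pullbackMonad p).obj D.A).hom) ≫ p := by
    rw [Category.assoc, ← proj₂_w, reassoc_of% h]
  -- `N` = ((x, e), e'); the multiplication drops e and returns `l`.
  let N := (isPullback_proj₂ ((pullbackMonad p).obj D.A)).lift k _ hk
  have hN₁ : N ≫ proj₂ p ((pullbackMonad p).obj D.A) = k := IsPullback.lift_fst _ _ _ _
  have hN₂ : N ≫ ((pullbackMonad p).obj ((pullbackMonad p).obj D.A)).hom =
      l ≫ ((pullbackMonad p).obj D.A).hom := IsPullback.lift_snd _ _ _ _
  have hl : N ≫ ((pullbackMonad p).μ.app D.A).left = l := by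
    refine (isPullback_proj₂ D.A).hom_ext ?_ ?_
    · rw [Category.assoc, mul_proj₂, reassoc_of% hN₁, h]
    · rw [Category.assoc]
      exact (congrArg (N ≫ ·) hμ).trans hN₂
  refine ⟨N ≫ ((pullbackMonad p).map D.a).left, ?_, ?_⟩
  · rw [Category.assoc, proj₂_naturality, reassoc_of% hN₁]
  · rw [Category.assoc, ← Des.mul_a, reassoc_of% hl]

lemma DescentCoequalizer.isKernelPair_of_isKernelPair {D : Des p} (K : DescentCoequalizer p D)
    {Y : C} {r : D.A.left ⟶ Y} (h : IsKernelPair r (proj₂ p D.A) D.a.left) :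
    IsKernelPair K.c (proj₂ p D.A) D.a.left := by
  obtain ⟨d, rfl⟩ : ∃ d, K.c ≫ d = r :=
    ⟨_, Cofork.IsColimit.π_desc' K.isColimit r h.w⟩
  exact h.cancel_right K.w

instance DescentCoequalizer.epi_c {D : Des p} (K : DescentCoequalizer p D) : Epi K.c :=
  ⟨fun _ _ => K.hom_ext⟩

/-- If x and y have the same image under the top arrow, then ξ^α(x, γ(y)) = y: both sides agree on
the top arrow and on γ, which are jointly monic in a pullback. -/
lemma Pb.isKernelPair_top (X : Pb p) :
    IsKernelPair X.obj.top (proj₂ p X.obj.left) (canonicalDescent p X).left := by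
  have factors : ∀ s : PullbackCone X.obj.top X.obj.top, ∃ k,
      k ≫ proj₂ p X.obj.left = s.fst ∧ k ≫ (canonicalDescent p X).left = s.snd := by
    intro s
    obtain ⟨k, hk₁, hk₂⟩ : ∃ k : s.pt ⟶ ((pullbackMonad p).obj X.obj.left).left,
        k ≫ proj₂ p X.obj.left = s.fst ∧
          k ≫ (canonicalDescent p X).left ≫ X.obj.left.hom = s.snd ≫ X.obj.left.hom :=
      Des.exists_lift ((Phi p).obj X) s.fst (s.snd ≫ X.obj.left.hom) (by
      have := s.condition =≫ X.obj.right.hom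
      simp only [Category.assoc, Sq.top_w] at this
      rw [Category.assoc]
      exact this)
    refine ⟨k, hk₁, X.property.hom_ext ?_ ((Category.assoc _ _ _).trans hk₂)⟩
    rw [Category.assoc, canonicalDescent_top, reassoc_of% hk₁]
    exact s.condition
  choose l hl₁ hl₂ using factors
  exact ⟨⟨(canonicalDescent_top p X).symm⟩, ⟨PullbackCone.IsLimit.mk _ l hl₁ hl₂
    (fun s k h₁ h₂ => Des.hom_ext_proj₂ (D := (Phi p).obj X)
      (h₁.trans (hl₁ s).symm) (h₂.trans (hl₂ s).symm))⟩⟩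

lemma Des.mk_congr {A : Over E} {a a' : (pullbackMonad p).obj A ⟶ A} {hu hm hu' hm'}
    (h : a = a') : (⟨A, a, hu, hm⟩ : Des p) = ⟨A, a', hu', hm'⟩ := by
  subst h
  rfl

lemma Des.eqToHom_f {D D' : Des p} (h : D = D') :
    (eqToHom h).f = eqToHom (congrArg Monad.Algebra.A h) := by
  subst h
  rfl

section Choice

variable {K : CoequalizerChoice p} (hK : ∀ D, isPullbackSq p ((PsiSq K).obj D))

/-- The equation π₂ ≫ c = ξ ≫ c is the one characterizing the canonical descent data of the
coequalizer square. The unit has underlying arrow an identity; `eqToHom` only transports along the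
equality of objects. -/
lemma exists_unit_eq :
    ∃ h : 𝟭 (Des p) = Psi K hK ⋙ Phi p, (adj K hK).unit = eqToHom h := by
  have hobj : ∀ D : Des p, D = (Phi p).obj ((Psi K hK).obj D) := fun D =>
    Des.mk_congr (Pb.hom_ext_left ((Psi K hK).obj D)
      ((K D).w.symm.trans (canonicalDescent_top p ((Psi K hK).obj D)).symm))
  refine ⟨CategoryTheory.Functor.ext hobj fun D D' f => Monad.Algebra.Hom.ext ?_, ?_⟩
  · rw [Monad.Algebra.comp_f, Monad.Algebra.comp_f, Des.eqToHom_f, Des.eqToHom_f]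
    exact ((Category.id_comp _).trans (Category.comp_id _)).symm
  · ext D : 2
    refine Monad.Algebra.Hom.ext ?_
    rw [eqToHom_app, Des.eqToHom_f]
    rfl

/-- The right side of the square is recovered from the top arrow because the latter is epi. -/
lemma DescentCoequalizer.square_eq {X : Pb p} (L : DescentCoequalizer p ((Phi p).obj X))
    (hpt : L.pt = X.obj.right.left) (hc : L.c = X.obj.top ≫ eqToHom hpt.symm) :
    L.square = X.obj := by
  obtain ⟨pt, c, w, hL⟩ := L
  dsimp at hpt
  subst hpt
  obtain rfl : c = X.obj.top := by simpa using hc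
  exact Sq.mk_eq (X := X.obj) (DescentCoequalizer.hom_ext _
    ((DescentCoequalizer.c_mediate _).trans X.obj.top_w.symm)) _

lemma counit_eq {X : Pb p} (h : (Psi K hK).obj ((Phi p).obj X) = X) :
    (adj K hK).counit.app X = eqToHom h := by
  refine ObjectProperty.hom_ext _ ((K _).square_hom_ext ?_)
  refine Eq.trans ?_ (Pb.eqToHom_left h).symm
  rfl

end Choice

end Descent

/-! ### Coequalizers of descent data and the pullback property -/

section Topos

variable {C : Type u} [Category.{v} C] [HasFiniteLimits C] [CartesianMonoidalCategory C]
  [MonoidalClosed C] [HasSubobjectClassifier C] {E B : C} {p : E ⟶ B} [ChosenPullbacksAlong p]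

lemma Des.exists_isKernelPair (D : Des p) :
    ∃ (Y : C) (r : D.A.left ⟶ Y), IsKernelPair r (proj₂ p D.A) D.a.left :=
  DescentPullback.exists_isKernelPair _ _ (fun _ _ _ => Des.hom_ext_proj₂)
    ((pullbackMonad p).η.app D.A).left (unit_proj₂ p D.A) D.unit_a (fun _ => D.euclidean)

/-- In an elementary topos, an epimorphism with kernel pair `(π₂, ξ)` is a coequalizer of `π₂`
and `ξ`. -/
def DescentCoequalizer.ofIsKernelPair {D : Des p} {H : C} (c : D.A.left ⟶ H) [Epi c]
    (h : IsKernelPair c (proj₂ p D.A) D.a.left) : DescentCoequalizer p D where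
  pt := H
  c := c
  w := h.w
  isColimit := Cofork.IsColimit.mk _
    (fun s => (exists_desc_of_isKernelPair h s.π s.condition).choose)
    (fun s => (exists_desc_of_isKernelPair h s.π s.condition).choose_spec)
    (fun s m hm => by
      rw [← cancel_epi c]
      exact hm.trans (exists_desc_of_isKernelPair h s.π s.condition).choose_spec.symm)

lemma nonempty_descentCoequalizer (D : Des p) : Nonempty (DescentCoequalizer p D) := by
  obtain ⟨Y, r, h⟩ := D.exists_isKernelPair
  obtain ⟨I, e, m, _, _, rfl⟩ := exists_epi_mono_factorization r
  exact ⟨.ofIsKernelPair e h.cancel_right_of_mono⟩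

/-- In an elementary topos, the square given by a coequalizer of descent data is a pullback. -/
lemma DescentCoequalizer.isPullbackSq_square {D : Des p} (K : DescentCoequalizer p D) :
    isPullbackSq p K.square := by
  obtain ⟨Y, r, hr⟩ := D.exists_isKernelPair
  have h := K.isKernelPair_of_isKernelPair hr
  let d : D.A.left ⟶ pullback K.mediate p := pullback.lift K.c D.A.hom K.c_mediate
  have hd₁ : d ≫ pullback.fst K.mediate p = K.c := pullback.lift_fst _ _ _
  have hd₂ : d ≫ pullback.snd K.mediate p = D.A.hom := pullback.lift_snd _ _ _
  have : Mono d := by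
    refine ⟨fun {Z} x y hxy => ?_⟩
    have hc : x ≫ K.c = y ≫ K.c := by rw [← hd₁, reassoc_of% hxy]
    have hγ : x ≫ D.A.hom = y ≫ D.A.hom := by rw [← hd₂, reassoc_of% hxy]
    -- The pair (x, y) in the relation is (x, γ(x)), so the unit law gives y = x.
    have hl : h.lift x y hc = x ≫ ((pullbackMonad p).η.app D.A).left := by
      refine (isPullback_proj₂ D.A).hom_ext ?_ ?_
      · rw [h.lift_fst, Category.assoc, unit_proj₂]
        exact (Category.comp_id _).symm
      · rw [← Des.a_hom, h.lift_snd_assoc, Category.assoc, reassoc_of% D.unit_a, hγ]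
    have := h.lift_snd x y hc
    rw [hl, Category.assoc, D.unit_a] at this
    exact (Category.comp_id _).symm.trans this
  have : Epi d := by
    -- On the cover `g`, the `H`-component lifts to `x`; moving `x` by ξ over the `E`-component
    -- keeps its class and gives a preimage under `d`.
    obtain ⟨W, g, x, _, hx⟩ := exists_epi_lift K.c (pullback.fst K.mediate p)
    obtain ⟨k, hk₁, hk₂⟩ := D.exists_lift x (g ≫ pullback.snd K.mediate p) (by
      rw [← K.c_mediate, reassoc_of% hx, pullback.condition, Category.assoc])
    refine epi_of_epi_fac (f := k ≫ D.a.left) (h := g) ?_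
    ext
    · rw [Category.assoc, Category.assoc, hd₁, ← K.w, reassoc_of% hk₁, hx]
    · rw [Category.assoc, Category.assoc, hd₂, hk₂]
  have := isIso_of_mono_of_epi d
  have sq : IsPullback K.c D.A.hom K.mediate p :=
    IsPullback.of_iso_pullback ⟨K.c_mediate⟩ (asIso d) hd₁ hd₂
  exact sq

/-- If `p` is an epimorphism in an elementary topos, the top arrow of a pullback square along `p`
is a coequalizer of its canonical descent data. -/
def Pb.descentCoequalizer [Epi p] (X : Pb p) : DescentCoequalizer p ((Phi p).obj X) :=
  have h : IsPullback X.obj.top X.obj.left.hom X.obj.right.hom p := X.property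
  have : Epi (X := ((Phi p).obj X).A.left) X.obj.top := epi_of_isPullback h
  .ofIsKernelPair (D := (Phi p).obj X) X.obj.top X.isKernelPair_top

end Topos

end DescentPullback

end

open DescentPullback in
theorem proposition1 {C : Type u} [Category.{v} C] [HasFiniteLimits C]
    [CartesianMonoidalCategory C] [MonoidalClosed C] [HasSubobjectClassifier C]
    {E B : C} (p : E ⟶ B) [ChosenPullbacksAlong p] :
    Nonempty (CoequalizerChoice p) ∧
    ∃ hpb : ∀ (K : CoequalizerChoice p) (D : Des p), isPullbackSq p ((PsiSq K).obj D),
      (∀ K : CoequalizerChoice p, ∃ h : 𝟭 (Des p) = Psi K (hpb K) ⋙ Phi p,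
        (adj K (hpb K)).unit = eqToHom h) ∧
      (Epi p →
        (Phi p).IsEquivalence ∧
        ∀ S : Set (Pb p), Set.InjOn (Phi p).obj S →
          ∃ K : CoequalizerChoice p, ∀ X ∈ S,
            ∃ h : (Psi K (hpb K)).obj ((Phi p).obj X) = X,
              (adj K (hpb K)).counit.app X = eqToHom h) := by
  have hpb : ∀ (K : CoequalizerChoice p) (D : Des p), isPullbackSq p ((PsiSq K).obj D) :=
    fun K D => (K D).isPullbackSq_square
  let K₀ : CoequalizerChoice p := fun D => (nonempty_descentCoequalizer D).some
  refine ⟨⟨K₀⟩, hpb, fun K => exists_unit_eq (hpb K), fun _ => ?_⟩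
  have hS : ∀ S : Set (Pb p), Set.InjOn (Phi p).obj S →
      ∃ K : CoequalizerChoice p, ∀ X ∈ S,
        ∃ h : (Psi K (hpb K)).obj ((Phi p).obj X) = X,
          (adj K (hpb K)).counit.app X = eqToHom h := by
    intro S hS
    obtain ⟨K, hK⟩ := exists_extension hS Pb.descentCoequalizer K₀
    refine ⟨K, fun X hX => ?_⟩
    have h : (Psi K (hpb K)).obj ((Phi p).obj X) = X := by
      refine ObjectProperty.FullSubcategory.ext ?_
      refine (congrArg DescentCoequalizer.square (hK X hX)).trans ?_
      exact DescentCoequalizer.square_eq X.descentCoequalizer rfl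
        (Category.comp_id X.obj.top).symm
    exact ⟨h, counit_eq (hpb K) h⟩
  refine ⟨?_, hS⟩
  have hη : ∀ D, IsIso ((adj K₀ (hpb K₀)).unit.app D) := by
    obtain ⟨h, e⟩ := exists_unit_eq (hpb K₀)
    rw [e]
    infer_instance
  have hε : ∀ X, IsIso ((adj K₀ (hpb K₀)).counit.app X) := by
    intro X
    obtain ⟨K, hK⟩ := hS {X} (Set.injOn_singleton _ _)
    obtain ⟨h, e⟩ := hK X rfl
    -- The counit for a choice adapted to `X` is an identity; counits for different choices differ
    -- by the isomorphism between left adjoints.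
    rw [← Adjunction.leftAdjointUniq_hom_app_counit (adj K₀ (hpb K₀)) (adj K (hpb K)), e]
    infer_instance
  exact (adj K₀ (hpb K₀)).toEquivalence.isEquivalence_inverse
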